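/- **Theorem 4.2 (Quenched Law of Large Numbers).** For every $n$ let $(w_x^+)_{x\in[n]}$ and $(w_x^-)_{x\in[n]}$ be positive weights (depending on $n$) with $\sum_{x} w_x^+=\sum_x w_x^-=:\mathbf w$, and assume that there are constants $M_0,M_1>1$, $M_2>0$ and $0<\eta<1$, not depending on $n$, such that for all $n$ $$M_0\le w_x^+\le M_1\quad(x\in[n]),\qquad \sum_{x\in[n]}(w_x^-)^{2+\eta}\le M_2\,n .$$ Let $G$ be the Chung–Lu digraph on $[n]$: the edges $x\to y$, $x\ne y$, are present independently with probability $p_{xy}=\big(w_x^+w_y^-\frac{\log n}{n}\big)\wedge 1$; let $\mathbb P$ be its law and $D_x^+$ the out-degree of $x$. Put $P(x,y)=1/D_x^+$ if $x\to y$ and $P(x,y)=0$ otherwise, and let $\mathbf P_x$ be the quenched law (that is, for a given realization of $G$) of the simple random walk $(X_s)_{s\ge 0}$ with transition matrix $P$ started at $x$ (killed at vertices without outgoing edges, if there are any). The mass of a path is $\mathbf m(x_0,\dots,x_t)=\prod_{i=0}^{t-1}P(x_i,x_{i+1})$, and $$\mathcal Q_{x,t}(\theta)=\mathbf P_x\big(\mathbf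 m(X_0,\dots,X_t)>\theta\big).$$ Let $$H=\sum_{x\in[n]}\frac{w_x^-}{\mathbf w}\,\mathbb E\big[\log (D_x^+\vee 1)\big],\qquad t_{\mathrm{ent}}=\frac{\log n}{H}.$$ Let $t=t_n\in\mathbb N$ and $\theta=\theta_n\in(0,1)$ be sequences such that, as $n\to\infty$, $t=\Theta(t_{\mathrm{ent}})$ and $$-\frac{\log\theta}{Ht}\longrightarrow\rho\in\mathbb R .$$ Then, as $n\to\infty$: (i) if $\rho<1$, then $\max_{x\in[n]}\mathcal Q_{x,t}(\theta)\to 0$ in $\mathbb P$-probability; (ii) if $\rho>1$, then $\min_{x\in[n]}\mathcal Q_{x,t}(\theta)\to 1$ in $\mathbb P$-probability. -/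

import Mathlib

open Filter Topology MeasureTheory ProbabilityTheory Asymptotics

noncomputable section

namespace ChungLu

/-! ### Simple random walk on a finite digraph -/

section Walk

variable {V : Type*} (G : Digraph V)

/-- The out-degree `D_x⁺` of the vertex `x`. -/
def outDegree (x : V) : ℕ := {y | G.Adj x y}.ncard

open Classical in
/-- The transition matrix of the simple random walk: `P(x, y) = 1 / D_x⁺` if `x → y`,
and `0` otherwise. -/
def transition (x y : V) : ℝ := if G.Adj x y then 1 / (outDegree G x : ℝ) else 0

/-- The probability mass `∏_{i < t} P(x_i, x_{i+1})` of a path `(x_0, …, x_t)`. -/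
def pathMass {t : ℕ} (p : Fin (t + 1) → V) : ℝ :=
  ∏ i : Fin t, transition G (p i.castSucc) (p i.succ)

open Classical in
/-- The quenched law of the trajectory `(X_0, …, X_t)` of the walk started at `x`: the trajectory
`(x_0, …, x_t)` has probability `1{x_0 = x} ∏_{i < t} P(x_i, x_{i+1})`. If some vertices have no
outgoing edge, then the walk is killed there. -/
def walkLaw [Fintype V] [MeasurableSpace V] (x : V) (t : ℕ) : Measure (Fin (t + 1) → V) :=
  ∑ p : Fin (t + 1) → V,
    (if p 0 = x then ENNReal.ofReal (pathMass G p) else 0) • Measure.dirac p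

/-- `Q_{x,t}(θ)`: the quenched probability that the path `(X_0, …, X_t)` followed by the walk started
at `x` has mass greater than `θ`. Killed trajectories do not contribute; continuing them along
non-edges would give the same value for `θ ≥ 0`, because their mass would be `0`. -/
def quenchedProb [Fintype V] [MeasurableSpace V] (x : V) (t : ℕ) (θ : ℝ) : ℝ :=
  (walkLaw G x t).real {p | θ < pathMass G p}

end Walk

/-! ### The Chung–Lu digraph -/

section Model

variable {n : ℕ} (wp wm : Fin n → ℝ)

/-- The connection probability `p_{xy} = (w_x⁺ w_y⁻ log n / n) ∧ 1` for `x ≠ y`; there are no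
loops. -/
def edgeProb (x y : Fin n) : ℝ :=
  if x = y then 0 else min (wp x * wm y * (Real.log n / n)) 1

/-- The law of the edge indicators of the Chung–Lu digraph: independent Bernoulli variables, the
one of the pair `(x, y)` having parameter `edgeProb wp wm x y`. For nonnegative weights this number
lies in `[0, 1]` and the projection `Set.projIcc` only repackages it. -/
def graphLaw : Measure (Fin n → Fin n → Bool) :=
  Measure.pi fun x => Measure.pi fun y =>
    bernoulliMeasure true false (Set.projIcc (0 : ℝ) 1 zero_le_one (edgeProb wp wm x y))

/-- The digraph with edge indicators `ω`: there is an edge from `x` to `y` iff `ω x y = true`. -/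
def graphOf (ω : Fin n → Fin n → Bool) : Digraph (Fin n) := Digraph.mk' ω

/-- The in-degree distribution `μ_in(x) = w_x⁻ / ∑_y w_y⁻`. -/
def muIn (x : Fin n) : ℝ := wm x / ∑ y, wm y

/-- The entropy `H`: the mean of `log (D_V⁺ ∨ 1)`, for a random vertex `V` with law `μ_in`
independent of the graph. -/
def entropy : ℝ :=
  ∑ x, muIn wm x * ∫ ω, Real.log (max (outDegree (graphOf ω) x : ℝ) 1) ∂(graphLaw wp wm)

/-- The entropic time `t_ent = log n / H`. -/
def entropicTime : ℝ := Real.log n / entropy wp wm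

end Model

/-- Convergence in probability of real random variables `X n`, each defined on its own probability
space `(Ω n, P n)`, to a constant `c`. -/
def TendstoInProbability {Ω : ℕ → Type*} [∀ n, MeasurableSpace (Ω n)]
    (P : ∀ n, Measure (Ω n)) (X : ∀ n, Ω n → ℝ) (c : ℝ) : Prop :=
  ∀ ε : ℝ, 0 < ε → Tendsto (fun n => P n {ω | ε ≤ |X n ω - c|}) atTop (𝓝 0)

end ChungLu

end

/-!
Since `M₀ > 1`, the mean out-degrees `∑_y p_{xy} ≥ M₀² log n - 1` exceed `log n` by a constant
factor. Hence Chernoff bounds together with a union bound over the vertices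
(`exists_measureReal_badDegrees_le`) show that, off an event of probability `O(n^{-δ})`, *all*
out-degrees lie in a window `[c log n, C log n]`. The moment assumption on the in-weights
ensures that no connection probability is truncated at `1` when `n` is large
(`eventually_edgeProb_untruncated`), which makes these means explicit.

Off that event every path of length `t` with positive mass has mass between `(C log n)^{-t}` and
`(c log n)^{-t}` (`pow_le_pathMass`, `pathMass_le_pow`), that is, `- log m = t (log log n + O(1))`.
The same window gives `H = log log n + O(1)` (`entropy_bounds`), the exceptional event being so
unlikely that the crude bound `log D ≤ log n` suffices there. As `log log n → ∞`, we have
`- log m = (1 + o(1)) H t` uniformly over all paths. So, for large `n` and off the exceptional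
event, all masses are below `θ` when `ρ < 1`, and `Q_{x,t}(θ) = 0` for every `x`; when `ρ > 1` all
positive masses exceed `θ`, and `Q_{x,t}(θ)` is the total mass of the paths from `x`, which is `1`
because there are no sinks (`sum_pathMass`). The relation `t = Θ(t_ent)` enters
through `t ≥ 1`.
-/

namespace ChungLu

/-! ### Masses of paths -/

section Walk

variable {V : Type*} (G : Digraph V)

lemma transition_nonneg (x y : V) : 0 ≤ transition G x y := by
  unfold transition
  split_ifs <;> positivity

lemma pathMass_nonneg {t : ℕ} (p : Fin (t + 1) → V) : 0 ≤ pathMass G p :=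
  Finset.prod_nonneg fun _ _ => transition_nonneg G _ _

lemma pathMass_le_pow {a : ℝ} (ha : 0 < a) (hG : ∀ x, a ≤ outDegree G x) {t : ℕ}
    (p : Fin (t + 1) → V) : pathMass G p ≤ (1 / a) ^ t := by
  have h : ∀ i ∈ Finset.univ, transition G (p (Fin.castSucc i)) (p (Fin.succ i)) ≤ 1 / a := by
    intro i _
    unfold transition
    split_ifs
    · exact one_div_le_one_div_of_le ha (hG _)
    · positivity
  simpa [pathMass] using Finset.prod_le_prod (fun i _ => transition_nonneg G _ _) h

lemma pow_le_pathMass {b : ℝ} (hG : ∀ x, 0 < outDegree G x) (hb : ∀ x, (outDegree G x : ℝ) ≤ b)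
    {t : ℕ} (p : Fin (t + 1) → V) (hp : pathMass G p ≠ 0) : (1 / b) ^ t ≤ pathMass G p := by
  have hb0 : 0 < b := (Nat.cast_pos.2 (hG (p 0))).trans_le (hb _)
  have h : ∀ i ∈ Finset.univ, 1 / b ≤ transition G (p (Fin.castSucc i)) (p (Fin.succ i)) := by
    intro i hi
    have hne := Finset.prod_ne_zero_iff.1 hp i hi
    unfold transition at hne ⊢
    split_ifs with hadj
    · exact one_div_le_one_div_of_le (Nat.cast_pos.2 (hG _)) (hb _)
    · simp [hadj] at hne
  simpa [pathMass] using Finset.prod_le_prod (fun i _ => by positivity) h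

lemma pathMass_cons {t : ℕ} (x : V) (q : Fin (t + 1) → V) :
    pathMass G (Fin.cons x q : Fin (t + 2) → V) = transition G x (q 0) * pathMass G q := by
  simp [pathMass, Fin.prod_univ_succ]

variable [Fintype V]

lemma sum_transition {x : V} (hx : 0 < outDegree G x) : ∑ y, transition G x y = 1 := by
  classical
  have hcard : (({y | G.Adj x y} : Finset V).card : ℝ) = outDegree G x := by
    rw [outDegree, Set.ncard_eq_toFinset_card']
    congr 2
    ext; simp
  have hne : (outDegree G x : ℝ) ≠ 0 := by exact_mod_cast hx.ne'
  unfold transition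
  rw [← Finset.sum_filter, Finset.sum_const, nsmul_eq_mul]
  convert mul_one_div_cancel hne

open Classical in
/-- The masses of the paths of length `t` from `x` sum to `1` when there is no sink. -/
lemma sum_pathMass (hG : ∀ x, 0 < outDegree G x) (t : ℕ) (x : V) :
    ∑ p : Fin (t + 1) → V, (if p 0 = x then pathMass G p else 0) = 1 := by
  induction t generalizing x with
  | zero =>
    rw [← (Equiv.funUnique (Fin 1) V).symm.sum_comp]
    simp [pathMass]
  | succ t ih =>
    rw [← (Fin.consEquiv (fun _ : Fin (t + 2) => V)).sum_comp, Fintype.sum_prod_type]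
    simp only [Fin.consEquiv_apply, Fin.cons_zero]
    rw [Finset.sum_eq_single x (by intro y _ hy; simp [hy]) (by simp)]
    have hcons : ∀ q : Fin (t + 1) → V, pathMass G (Fin.consEquiv (fun _ => V) (x, q)) =
        transition G x (q 0) * pathMass G q := fun q => pathMass_cons G x q
    simp only [if_true, hcons]
    calc ∑ q : Fin (t + 1) → V, transition G x (q 0) * pathMass G q
        = ∑ q : Fin (t + 1) → V, ∑ y, transition G x y * (if q 0 = y then pathMass G q else 0) := by
          simp
      _ = ∑ y, transition G x y := by
          rw [Finset.sum_comm]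
          simp only [← Finset.mul_sum, ih, mul_one]
      _ = 1 := sum_transition G (hG x)

variable [MeasurableSpace V]

lemma quenchedProb_eq_zero {x : V} {t : ℕ} {θ : ℝ}
    (h : ∀ p : Fin (t + 1) → V, pathMass G p ≤ θ) : quenchedProb G x t θ = 0 := by
  have : {p : Fin (t + 1) → V | θ < pathMass G p} = ∅ := by
    ext p; simpa using h p
  simp [quenchedProb, this]

lemma quenchedProb_eq_one [MeasurableSingletonClass V] (hG : ∀ x, 0 < outDegree G x) {x : V}
    {t : ℕ} {θ : ℝ} (h : ∀ p : Fin (t + 1) → V, pathMass G p ≠ 0 → θ < pathMass G p) :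
    quenchedProb G x t θ = 1 := by
  classical
  have hm : MeasurableSet {p : Fin (t + 1) → V | θ < pathMass G p} :=
    (Set.toFinite _).measurableSet
  have hterm : ∀ p : Fin (t + 1) → V,
      (if p 0 = x then ENNReal.ofReal (pathMass G p) else 0) *
        Set.indicator {p : Fin (t + 1) → V | θ < pathMass G p} 1 p =
      ENNReal.ofReal (if p 0 = x then pathMass G p else 0) := by
    intro p
    by_cases hx : p 0 = x
    · by_cases hp : pathMass G p = 0
      · simp [hp]
      · simp [hx, h p hp]
    · simp [hx]
  have : walkLaw G x t {p | θ < pathMass G p} = 1 := by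
    simp only [walkLaw, Measure.coe_finsetSum, Finset.sum_apply, Measure.smul_apply,
      Measure.dirac_apply' _ hm, smul_eq_mul]
    calc _ = ∑ p : Fin (t + 1) → V, ENNReal.ofReal (if p 0 = x then pathMass G p else 0) :=
          Finset.sum_congr rfl fun p _ => by convert hterm p
      _ = 1 := by
          rw [← ENNReal.ofReal_sum_of_nonneg, sum_pathMass G hG, ENNReal.ofReal_one]
          intro p _
          split_ifs
          exacts [pathMass_nonneg G p, le_rfl]
  simp [quenchedProb, measureReal_def, this]

end Walk

/-! ### Exponential moments of the out-degrees -/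

lemma mgf_sum_bernoulli_le {ι : Type*} [Fintype ι] (p : ι → unitInterval) (s : ℝ) :
    mgf (fun b : ι → Bool => ∑ i, if b i then (1 : ℝ) else 0)
      (Measure.pi fun i => bernoulliMeasure true false (p i)) s ≤
      Real.exp ((Real.exp s - 1) * ∑ i, (p i : ℝ)) := by
  have h : mgf (fun b : ι → Bool => ∑ i, if b i then (1 : ℝ) else 0)
      (Measure.pi fun i => bernoulliMeasure true false (p i)) s =
      ∏ i, ((p i : ℝ) * Real.exp s + (1 - p i)) := by
    simp only [mgf, Finset.mul_sum, Real.exp_sum]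
    rw [integral_fintype_prod_eq_prod
      (f := fun (_ : ι) (b : Bool) => Real.exp (s * if b then 1 else 0))]
    simp [integral_bernoulliMeasure]
  rw [h, Finset.mul_sum, Real.exp_sum]
  refine Finset.prod_le_prod (fun i _ => ?_) (fun i _ => ?_)
  · have := (p i).2.1
    have := (p i).2.2
    have := Real.exp_pos s
    have : 0 ≤ (p i : ℝ) * Real.exp s := by positivity
    linarith
  · have := Real.add_one_le_exp ((Real.exp s - 1) * (p i : ℝ))
    linarith

section Model

variable {n : ℕ} {wp wm : Fin n → ℝ}

instance : IsProbabilityMeasure (graphLaw wp wm) := by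
  unfold graphLaw; infer_instance

lemma outDegree_graphOf (ω : Fin n → Fin n → Bool) (x : Fin n) :
    (outDegree (graphOf ω) x : ℝ) = ∑ y, if ω x y then (1 : ℝ) else 0 := by
  simp [outDegree, graphOf, Set.ncard_eq_toFinset_card', Finset.sum_boole]

lemma edgeProb_mem (hwp : ∀ x, 0 ≤ wp x) (hwm : ∀ x, 0 ≤ wm x) (x y : Fin n) :
    edgeProb wp wm x y ∈ Set.Icc (0 : ℝ) 1 := by
  have := hwp x
  have := hwm y
  have := Real.log_natCast_nonneg n
  unfold edgeProb
  split_ifs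
  · simp
  · exact ⟨le_min (by positivity) zero_le_one, min_le_right _ _⟩

lemma mgf_outDegree_le (hwp : ∀ x, 0 ≤ wp x) (hwm : ∀ x, 0 ≤ wm x) (x : Fin n) (s : ℝ) :
    mgf (fun ω => (outDegree (graphOf ω) x : ℝ)) (graphLaw wp wm) s ≤
      Real.exp ((Real.exp s - 1) * ∑ y, edgeProb wp wm x y) := by
  have h := mgf_sum_bernoulli_le
    (fun y => Set.projIcc (0 : ℝ) 1 zero_le_one (edgeProb wp wm x y)) s
  have hp : ∀ y, ((Set.projIcc (0 : ℝ) 1 zero_le_one (edgeProb wp wm x y) : unitInterval) : ℝ) =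
      edgeProb wp wm x y := fun y => by
    rw [Set.projIcc_of_mem _ (edgeProb_mem hwp hwm x y)]
  simp only [hp] at h
  refine le_trans (le_of_eq ?_) h
  simp only [mgf, outDegree_graphOf]
  exact integral_comp_eval
    (μ := fun x => Measure.pi fun y =>
      bernoulliMeasure true false (Set.projIcc (0 : ℝ) 1 zero_le_one (edgeProb wp wm x y)))
    (f := fun b : Fin n → Bool => Real.exp (s * ∑ y, if b y then (1 : ℝ) else 0))
    Integrable.of_finite.aestronglyMeasurable

lemma sum_edgeProb_eq (hcut : ∀ x y, wp x * wm y * (Real.log n / n) ≤ 1) (x : Fin n) :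
    ∑ y, edgeProb wp wm x y =
      wp x * (∑ y, wm y) * (Real.log n / n) - wp x * wm x * (Real.log n / n) := by
  have h : ∀ y, edgeProb wp wm x y = wp x * wm y * (Real.log n / n) -
      if x = y then wp x * wm x * (Real.log n / n) else 0 := by
    intro y
    unfold edgeProb
    split_ifs with hxy
    · subst hxy; simp
    · simp [hcut x y]
  simp [h, Finset.sum_sub_distrib, Finset.mul_sum, Finset.sum_mul]

/-- Bounds on the mean out-degree, when no connection probability is truncated at `1`. -/
lemma sum_edgeProb_bounds {M₀ M₁ : ℝ} (hM₀ : 0 < M₀) (hwp : ∀ x, M₀ ≤ wp x ∧ wp x ≤ M₁)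
    (hwm : ∀ x, 0 < wm x) (hsum : ∑ x, wp x = ∑ x, wm x)
    (hcut : ∀ x y, wp x * wm y * (Real.log n / n) ≤ 1) (x : Fin n) :
    M₀ ^ 2 * Real.log n - 1 ≤ ∑ y, edgeProb wp wm x y ∧
      ∑ y, edgeProb wp wm x y ≤ M₁ ^ 2 * Real.log n := by
  have hn : (0 : ℝ) < n := Nat.cast_pos.2 x.pos
  have hL := Real.log_natCast_nonneg n
  have hx := hwp x
  have hlow : M₀ * n ≤ ∑ y, wm y := by
    rw [← hsum]
    simpa [mul_comm] using Finset.card_nsmul_le_sum Finset.univ wp M₀ fun y _ => (hwp y).1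
  have hup : ∑ y, wm y ≤ M₁ * n := by
    rw [← hsum]
    simpa [mul_comm] using Finset.sum_le_card_nsmul Finset.univ wp M₁ fun y _ => (hwp y).2
  have hself : 0 ≤ wp x * wm x * (Real.log n / n) := by
    have := hwm x
    have : 0 < wp x := by linarith
    positivity
  rw [sum_edgeProb_eq hcut x]
  constructor
  · have h1 : M₀ * (M₀ * n) ≤ wp x * ∑ y, wm y :=
      mul_le_mul hx.1 hlow (by positivity) (by linarith)
    have h2 := mul_le_mul_of_nonneg_right h1 (div_nonneg hL hn.le)
    have h3 : M₀ * (M₀ * n) * (Real.log n / n) = M₀ ^ 2 * Real.log n := by field_simp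
    have := hcut x x
    linarith
  · have h1 : wp x * ∑ y, wm y ≤ M₁ * (M₁ * n) :=
      mul_le_mul hx.2 hup (by nlinarith) (by linarith)
    have h2 := mul_le_mul_of_nonneg_right h1 (div_nonneg hL hn.le)
    have h3 : M₁ * (M₁ * n) * (Real.log n / n) = M₁ ^ 2 * Real.log n := by field_simp
    linarith

/-! ### Concentration of the out-degrees -/

/-- The event that some out-degree leaves the window `[c log n, C log n]`. -/
def badDegrees (n : ℕ) (c C : ℝ) : Set (Fin n → Fin n → Bool) :=
  {ω | ∃ x, (outDegree (graphOf ω) x : ℝ) ≤ c * Real.log n ∨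
    C * Real.log n ≤ outDegree (graphOf ω) x}

lemma notMem_badDegrees {c C : ℝ} {ω : Fin n → Fin n → Bool} :
    ω ∉ badDegrees n c C ↔ ∀ x, c * Real.log n < outDegree (graphOf ω) x ∧
      (outDegree (graphOf ω) x : ℝ) < C * Real.log n := by
  simp [badDegrees]

/-- Chernoff bounds and a union bound: all out-degrees are of order `log n`. This is where
`M₀ > 1` enters, as the lower tail must beat the number `n` of vertices. -/
lemma exists_measureReal_badDegrees_le {M₀ : ℝ} (M₁ : ℝ) (hM₀ : 1 < M₀) :
    ∃ c C δ : ℝ, 0 < c ∧ 0 < C ∧ 0 < δ ∧ ∀ (n : ℕ) (wp wm : Fin n → ℝ), 1 ≤ n →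
      (∀ x, M₀ ≤ wp x ∧ wp x ≤ M₁) → (∀ x, 0 < wm x) → ∑ x, wp x = ∑ x, wm x →
      (∀ x y, wp x * wm y * (Real.log n / n) ≤ 1) →
      (graphLaw wp wm).real (badDegrees n c C) ≤ 4 * Real.exp (-δ * Real.log n) := by
  -- `q = 1 - e^{-l}` is close enough to `1` that `M₀² q` still exceeds `1`
  set q : ℝ := (1 + M₀ ^ 2) / (2 * M₀ ^ 2) with hq
  have hM2 : 1 < M₀ ^ 2 := by nlinarith
  have hq0 : 0 < q := by positivity
  have hq1 : q < 1 := by rw [hq, div_lt_one (by positivity)]; linarith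
  have hMq : M₀ ^ 2 * q = (1 + M₀ ^ 2) / 2 := by rw [hq]; field_simp
  set l : ℝ := -Real.log (1 - q) with hl
  have hl0 : 0 < l := by
    have := Real.log_neg (show 0 < 1 - q by linarith) (by linarith)
    linarith
  have hexp : Real.exp (-l) = 1 - q := by rw [hl, neg_neg, Real.exp_log (by linarith)]
  set δ : ℝ := min ((M₀ ^ 2 - 1) / 4) 1 with hδ
  have hδ0 : 0 < δ := lt_min (by linarith) one_pos
  have hδ1 : δ ≤ 1 := min_le_right _ _
  have hδ2 : δ ≤ (M₀ ^ 2 - 1) / 4 := min_le_left _ _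
  refine ⟨δ / l, 2 * M₁ ^ 2 + 2, δ, by positivity, by positivity, hδ0, ?_⟩
  intro n wp wm hn hwp hwm hsum hcut
  set L := Real.log n with hLdef
  have hL : 0 ≤ L := Real.log_natCast_nonneg n
  have hn0 : (0 : ℝ) < n := by exact_mod_cast hn
  have hnL : (n : ℝ) = Real.exp L := (Real.exp_log hn0).symm
  have hwp0 : ∀ x, 0 ≤ wp x := fun x => by linarith [(hwp x).1]
  have hwm0 : ∀ x, 0 ≤ wm x := fun x => (hwm x).le
  have he : Real.exp 1 ≤ 3 := by linarith [Real.exp_one_lt_d9]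
  have hlower : ∀ x, (graphLaw wp wm).real
      {ω | (outDegree (graphOf ω) x : ℝ) ≤ δ / l * L} ≤ 3 * Real.exp (-(1 + δ) * L) := by
    intro x
    have hmean := (sum_edgeProb_bounds (by linarith) hwp hwm hsum hcut x).1
    have h1 := measure_le_le_exp_mul_mgf (μ := graphLaw wp wm)
      (X := fun ω => (outDegree (graphOf ω) x : ℝ)) (δ / l * L)
      (show -l ≤ 0 by linarith) Integrable.of_finite
    refine h1.trans ((mul_le_mul_of_nonneg_left (mgf_outDegree_le hwp0 hwm0 x (-l))
      (Real.exp_pos _).le).trans ?_)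
    rw [← Real.exp_add, hexp]
    calc _ ≤ Real.exp (1 + -(1 + δ) * L) := by
          refine Real.exp_le_exp.2 ?_
          have h2 : - -l * (δ / l * L) = δ * L := by field_simp
          have h3 := mul_le_mul_of_nonneg_left hmean hq0.le
          have h4 : q * (M₀ ^ 2 * L - 1) = (1 + M₀ ^ 2) / 2 * L - q := by rw [← hMq]; ring
          have h5 := mul_le_mul_of_nonneg_right hδ2 hL
          rw [h2]
          linarith
      _ ≤ _ := by rw [Real.exp_add]; gcongr
  have hupper : ∀ x, (graphLaw wp wm).real
      {ω | (2 * M₁ ^ 2 + 2) * L ≤ (outDegree (graphOf ω) x : ℝ)} ≤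
        Real.exp (-(1 + δ) * L) := by
    intro x
    have hmean := (sum_edgeProb_bounds (by linarith) hwp hwm hsum hcut x).2
    have hmean0 : 0 ≤ ∑ y, edgeProb wp wm x y :=
      Finset.sum_nonneg fun y _ => (edgeProb_mem hwp0 hwm0 x y).1
    have h1 := measure_ge_le_exp_mul_mgf (μ := graphLaw wp wm)
      (X := fun ω => (outDegree (graphOf ω) x : ℝ)) ((2 * M₁ ^ 2 + 2) * L)
      zero_le_one Integrable.of_finite
    refine h1.trans ((mul_le_mul_of_nonneg_left (mgf_outDegree_le hwp0 hwm0 x 1)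
      (Real.exp_pos _).le).trans ?_)
    rw [← Real.exp_add]
    refine Real.exp_le_exp.2 ?_
    have h2 := mul_le_mul_of_nonneg_right (show Real.exp 1 - 1 ≤ 2 by linarith) hmean0
    have h3 := mul_le_mul_of_nonneg_right hδ1 hL
    linarith
  have hunion : badDegrees n (δ / l) (2 * M₁ ^ 2 + 2) ⊆
      ⋃ x, ({ω | (outDegree (graphOf ω) x : ℝ) ≤ δ / l * L} ∪
        {ω | (2 * M₁ ^ 2 + 2) * L ≤ (outDegree (graphOf ω) x : ℝ)}) := by
    rintro ω ⟨x, hx⟩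
    exact Set.mem_iUnion.2 ⟨x, hx⟩
  calc (graphLaw wp wm).real (badDegrees n (δ / l) (2 * M₁ ^ 2 + 2))
      ≤ ∑ x, (graphLaw wp wm).real ({ω | (outDegree (graphOf ω) x : ℝ) ≤ δ / l * L} ∪
        {ω | (2 * M₁ ^ 2 + 2) * L ≤ (outDegree (graphOf ω) x : ℝ)}) :=
        (measureReal_mono hunion).trans (measureReal_iUnion_fintype_le _)
    _ ≤ ∑ _x : Fin n, 4 * Real.exp (-(1 + δ) * L) := by
        refine Finset.sum_le_sum fun x _ => (measureReal_union_le _ _).trans ?_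
        linarith [hlower x, hupper x]
    _ = 4 * Real.exp (-δ * L) := by
        rw [Finset.sum_const, Finset.card_univ, Fintype.card_fin, nsmul_eq_mul, hnL,
          show -(1 + δ) * L = -L + -δ * L by ring, Real.exp_add, Real.exp_neg]
        have := Real.exp_pos L
        field_simp

/-! ### The entropy -/

lemma sum_muIn (hn : 1 ≤ n) (hwm : ∀ x, 0 < wm x) : ∑ x, muIn wm x = 1 := by
  have : Nonempty (Fin n) := ⟨⟨0, hn⟩⟩
  have h : 0 < ∑ y, wm y := Finset.sum_pos (fun y _ => hwm y) Finset.univ_nonempty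
  simp [muIn, ← Finset.sum_div, h.ne']

/-- Up to the contribution of the atypical graphs, the entropy is the logarithm of a typical
out-degree. -/
lemma entropy_bounds {c C : ℝ} (hn : 1 ≤ n) (hwm : ∀ x, 0 < wm x) (hc : 1 ≤ c * Real.log n)
    (hC : 1 ≤ C * Real.log n) :
    Real.log (c * Real.log n) -
        Real.log (c * Real.log n) * (graphLaw wp wm).real (badDegrees n c C) ≤ entropy wp wm ∧
      entropy wp wm ≤ Real.log (C * Real.log n) +
        Real.log n * (graphLaw wp wm).real (badDegrees n c C) := by
  have hmu0 : ∀ x, 0 ≤ muIn wm x := fun x =>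
    div_nonneg (hwm x).le (Finset.sum_nonneg fun y _ => (hwm y).le)
  have hmeas : MeasurableSet (badDegrees n c C) := (Set.toFinite _).measurableSet
  have hint : ∀ a b : ℝ,
      ∫ ω, (a + b * (badDegrees n c C).indicator 1 ω) ∂(graphLaw wp wm) =
        a + b * (graphLaw wp wm).real (badDegrees n c C) := by
    intro a b
    rw [integral_add Integrable.of_finite Integrable.of_finite, integral_const_mul,
      integral_indicator_one hmeas]
    simp
  have hclog : 0 ≤ Real.log (c * Real.log n) := Real.log_nonneg hc
  have hClog : 0 ≤ Real.log (C * Real.log n) := Real.log_nonneg hC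
  have hn1 : (1 : ℝ) ≤ n := by exact_mod_cast hn
  have hdeg : ∀ ω : Fin n → Fin n → Bool, ∀ x, (outDegree (graphOf ω) x : ℝ) ≤ n := by
    intro ω x
    rw [outDegree_graphOf]
    calc _ ≤ ∑ _y : Fin n, (1 : ℝ) := Finset.sum_le_sum fun y _ => by split_ifs <;> norm_num
      _ = n := by simp
  have hlow : ∀ x, Real.log (c * Real.log n) +
      -Real.log (c * Real.log n) * (graphLaw wp wm).real (badDegrees n c C) ≤
      ∫ ω, Real.log (max (outDegree (graphOf ω) x : ℝ) 1) ∂(graphLaw wp wm) := by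
    intro x
    rw [← hint]
    refine integral_mono Integrable.of_finite Integrable.of_finite fun ω => ?_
    by_cases hω : ω ∈ badDegrees n c C
    · simpa [hω] using Real.log_nonneg (le_max_right _ _)
    · simp only [Set.indicator_of_notMem hω, mul_zero, add_zero]
      rw [notMem_badDegrees] at hω
      exact Real.log_le_log (by linarith) ((hω x).1.le.trans (le_max_left _ _))
  have hup : ∀ x, ∫ ω, Real.log (max (outDegree (graphOf ω) x : ℝ) 1) ∂(graphLaw wp wm) ≤
      Real.log (C * Real.log n) +
        Real.log n * (graphLaw wp wm).real (badDegrees n c C) := by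
    intro x
    rw [← hint]
    refine integral_mono Integrable.of_finite Integrable.of_finite fun ω => ?_
    have hpos : (0 : ℝ) < max (outDegree (graphOf ω) x : ℝ) 1 := by positivity
    by_cases hω : ω ∈ badDegrees n c C
    · have := Real.log_le_log hpos (max_le (hdeg ω x) hn1)
      simp only [Set.indicator_of_mem hω, Pi.one_apply, mul_one]
      linarith
    · simp only [Set.indicator_of_notMem hω, mul_zero, add_zero]
      rw [notMem_badDegrees] at hω
      exact Real.log_le_log hpos (max_le (hω x).2.le hC)
  constructor
  · calc _ = ∑ x, muIn wm x * (Real.log (c * Real.log n) +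
          -Real.log (c * Real.log n) * (graphLaw wp wm).real (badDegrees n c C)) := by
          rw [← Finset.sum_mul, sum_muIn hn hwm]; ring
      _ ≤ _ := Finset.sum_le_sum fun x _ => mul_le_mul_of_nonneg_left (hlow x) (hmu0 x)
  · calc entropy wp wm ≤ ∑ x, muIn wm x * (Real.log (C * Real.log n) +
          Real.log n * (graphLaw wp wm).real (badDegrees n c C)) :=
          Finset.sum_le_sum fun x _ => mul_le_mul_of_nonneg_left (hup x) (hmu0 x)
      _ = _ := by rw [← Finset.sum_mul, sum_muIn hn hwm]; ring

end Model

/-! ### Asymptotics -/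

lemma tendsto_log_natCast : Tendsto (fun n : ℕ => Real.log n) atTop atTop :=
  Real.tendsto_log_atTop.comp tendsto_natCast_atTop_atTop

/-- Since `(w_y⁻)² ≤ 1 + M₂ n` for every `y`, no connection probability is truncated at `1` for
large `n`. -/
lemma eventually_edgeProb_untruncated {M₀ M₁ M₂ η : ℝ} (hM₀ : 1 < M₀) (hM₁ : 1 < M₁)
    (hM₂ : 0 < M₂) (hη₀ : 0 < η) {wp wm : (n : ℕ) → Fin n → ℝ} (hwm_pos : ∀ n x, 0 < wm n x)
    (hwp : ∀ n x, M₀ ≤ wp n x ∧ wp n x ≤ M₁)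
    (hwm : ∀ n, ∑ x, (wm n x) ^ (2 + η) ≤ M₂ * n) :
    ∀ᶠ n : ℕ in atTop, ∀ x y, wp n x * wm n y * (Real.log n / n) ≤ 1 := by
  have hκ : 0 < 1 / (M₁ ^ 2 * (1 + M₂)) := by positivity
  have hlog := ((Real.isLittleO_pow_log_id_atTop (n := 2)).comp_tendsto
    (tendsto_natCast_atTop_atTop (R := ℝ))).def hκ
  filter_upwards [hlog, eventually_ge_atTop 1] with n hn hn1 x y
  have hn0 : (1 : ℝ) ≤ n := by exact_mod_cast hn1
  have hL := Real.log_natCast_nonneg n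
  simp only [Function.comp_apply, id, Real.norm_eq_abs, abs_of_nonneg (pow_nonneg hL 2),
    abs_of_nonneg (zero_le_one.trans hn0)] at hn
  have hsq : wm n y ^ 2 ≤ (1 + M₂) * n := by
    have hy := hwm_pos n y
    rcases le_total (wm n y) 1 with h | h
    · nlinarith
    · have h1 : wm n y ^ (2 : ℝ) ≤ wm n y ^ (2 + η) :=
        Real.rpow_le_rpow_of_exponent_le h (by linarith)
      have h2 : wm n y ^ (2 + η) ≤ ∑ z, wm n z ^ (2 + η) :=
        Finset.single_le_sum (f := fun z => wm n z ^ (2 + η))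
          (fun z _ => Real.rpow_nonneg (hwm_pos n z).le _) (Finset.mem_univ y)
      rw [Real.rpow_two] at h1
      linarith [hwm n]
  have hx0 : 0 < wp n x := by linarith [(hwp n x).1]
  have hkey : (wp n x * wm n y * Real.log n) ^ 2 ≤ (n : ℝ) ^ 2 := by
    calc (wp n x * wm n y * Real.log n) ^ 2
        = wp n x ^ 2 * wm n y ^ 2 * Real.log n ^ 2 := by ring
      _ ≤ M₁ ^ 2 * ((1 + M₂) * n) * (1 / (M₁ ^ 2 * (1 + M₂)) * n) := by
          gcongr
          exact (hwp n x).2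
      _ = (n : ℝ) ^ 2 := by field_simp
  rw [← mul_div_assoc, div_le_one (by linarith)]
  exact (sq_le_sq₀ (by have := hwm_pos n y; positivity) (by linarith)).1 hkey

end ChungLu

open ChungLu in
theorem theorem4p2
    (M₀ M₁ M₂ η : ℝ) (hM₀ : 1 < M₀) (hM₁ : 1 < M₁) (hM₂ : 0 < M₂) (hη₀ : 0 < η) (hη₁ : η < 1)
    (wp wm : (n : ℕ) → Fin n → ℝ)
    (hwm_pos : ∀ n x, 0 < wm n x)
    (hsum : ∀ n, ∑ x, wp n x = ∑ x, wm n x)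
    (hwp : ∀ n x, M₀ ≤ wp n x ∧ wp n x ≤ M₁)
    (hwm : ∀ n, ∑ x, (wm n x) ^ (2 + η) ≤ M₂ * n)
    (t : ℕ → ℕ) (θ : ℕ → ℝ) (ρ : ℝ)
    (hθ : ∀ n, 0 < θ n ∧ θ n < 1)
    (ht : (fun n => (t n : ℝ)) =Θ[atTop] fun n => ChungLu.entropicTime (wp n) (wm n))
    (hρ : Tendsto (fun n => -Real.log (θ n) / (ChungLu.entropy (wp n) (wm n) * t n))
      atTop (𝓝 ρ)) :
    (ρ < 1 → ChungLu.TendstoInProbability (fun n => ChungLu.graphLaw (wp n) (wm n))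
      (fun n ω => ⨆ x : Fin n, ChungLu.quenchedProb (ChungLu.graphOf ω) x (t n) (θ n)) 0) ∧
    (1 < ρ → ChungLu.TendstoInProbability (fun n => ChungLu.graphLaw (wp n) (wm n))
      (fun n ω => ⨅ x : Fin n, ChungLu.quenchedProb (ChungLu.graphOf ω) x (t n) (θ n)) 1) := by
  obtain ⟨c, C, δ, hc, hC, hδ, hbad⟩ := exists_measureReal_badDegrees_le M₁ hM₀
  have hbad' : ∀ᶠ n : ℕ in atTop, (graphLaw (wp n) (wm n)).real (badDegrees n c C) ≤
      4 * Real.exp (-δ * Real.log n) := by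
    filter_upwards [eventually_edgeProb_untruncated hM₀ hM₁ hM₂ hη₀ hwm_pos hwp hwm,
      eventually_ge_atTop 1] with n hcut hn
    exact hbad n _ _ hn (hwp n) (hwm_pos n) (hsum n) hcut
  have hbad0 : Tendsto (fun n => graphLaw (wp n) (wm n) (badDegrees n c C)) atTop (𝓝 0) := by
    have h1 : Tendsto (fun n : ℕ => 4 * Real.exp (-δ * Real.log n)) atTop (𝓝 0) := by
      have := Real.tendsto_exp_atBot.comp
        (tendsto_log_natCast.const_mul_atTop_of_neg (neg_lt_zero.2 hδ))
      simpa using this.const_mul 4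
    have h2 := squeeze_zero' (Eventually.of_forall fun n => measureReal_nonneg) hbad' h1
    rw [← ENNReal.tendsto_toReal_iff (fun n => measure_ne_top _ _) ENNReal.zero_ne_top]
    simpa [measureReal_def] using h2
  -- it suffices that the random variable equals its limit off the bad event
  have hprob : ∀ (X : ∀ n, (Fin n → Fin n → Bool) → ℝ) (a : ℝ),
      (∀ᶠ n in atTop, ∀ ω ∉ badDegrees n c C, X n ω = a) →
      TendstoInProbability (fun n => graphLaw (wp n) (wm n)) X a := by
    intro X a h ε hε
    refine tendsto_of_tendsto_of_tendsto_of_le_of_le' tendsto_const_nhds hbad0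
      (Eventually.of_forall fun n => zero_le) ?_
    filter_upwards [h] with n hn
    refine measure_mono fun ω hω => ?_
    by_contra hcon
    simp only [Set.mem_ofPred_eq, hn ω hcon, sub_self, abs_zero] at hω
    linarith
  have hLL : Tendsto (fun n : ℕ => Real.log (Real.log n)) atTop atTop :=
    Real.tendsto_log_atTop.comp tendsto_log_natCast
  have hlarge : ∀ᶠ n : ℕ in atTop, 1 ≤ n ∧ 0 < Real.log n ∧ 1 ≤ c * Real.log n ∧
      1 ≤ C * Real.log n := by
    filter_upwards [eventually_ge_atTop 1, tendsto_log_natCast.eventually_gt_atTop 0,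
      (tendsto_log_natCast.const_mul_atTop hc).eventually_ge_atTop 1,
      (tendsto_log_natCast.const_mul_atTop hC).eventually_ge_atTop 1] with n h1 h2 h3 h4
    exact ⟨h1, h2, h3, h4⟩
  -- the entropy is `log log n + O(1)`
  obtain ⟨K, hK⟩ : ∃ K : ℝ, ∀ᶠ n : ℕ in atTop,
      |entropy (wp n) (wm n) - Real.log (Real.log n)| ≤ K := by
    refine ⟨max (4 * c / δ - Real.log c) (Real.log C + 4 / δ), ?_⟩
    filter_upwards [hlarge, hbad'] with n ⟨hn, hL, hcL, hCL⟩ hb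
    obtain ⟨h1, h2⟩ := entropy_bounds (wp := wp n) hn (hwm_pos n) hcL hCL
    have hb0 : 0 ≤ (graphLaw (wp n) (wm n)).real (badDegrees n c C) := measureReal_nonneg
    have hLb : Real.log n * (graphLaw (wp n) (wm n)).real (badDegrees n c C) ≤ 4 / δ := by
      refine (mul_le_mul_of_nonneg_left hb hL.le).trans ?_
      rw [neg_mul, Real.exp_neg, le_div_iff₀ hδ]
      have h3 := Real.add_one_le_exp (δ * Real.log n)
      have h4 := Real.exp_pos (δ * Real.log n)
      rw [show Real.log n * (4 * (Real.exp (δ * Real.log n))⁻¹) * δ =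
        4 * (δ * Real.log n) / Real.exp (δ * Real.log n) by field_simp, div_le_iff₀ h4]
      linarith
    have hcb : Real.log (c * Real.log n) *
        (graphLaw (wp n) (wm n)).real (badDegrees n c C) ≤ 4 * c / δ := by
      calc _ ≤ c * Real.log n * (graphLaw (wp n) (wm n)).real (badDegrees n c C) :=
            mul_le_mul_of_nonneg_right (Real.log_le_self (by linarith)) hb0
        _ = c * (Real.log n * (graphLaw (wp n) (wm n)).real (badDegrees n c C)) := by ring
        _ ≤ c * (4 / δ) := by gcongr
        _ = _ := by ring
    rw [Real.log_mul hc.ne' hL.ne'] at h1 hcb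
    rw [Real.log_mul hC.ne' hL.ne'] at h2
    rw [abs_le]
    constructor
    · linarith [le_max_left (4 * c / δ - Real.log c) (Real.log C + 4 / δ)]
    · linarith [le_max_right (4 * c / δ - Real.log c) (Real.log C + 4 / δ)]
  have hH0 : ∀ᶠ n : ℕ in atTop, 0 < entropy (wp n) (wm n) := by
    filter_upwards [hK, hLL.eventually_gt_atTop K] with n h1 h2
    linarith [(abs_le.1 h1).1]
  have ht0 : ∀ᶠ n : ℕ in atTop, (0 : ℝ) < t n := by
    obtain ⟨A, hA⟩ := ht.2.bound
    filter_upwards [hA, hH0, hlarge] with n h1 h2 h3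
    rcases Nat.eq_zero_or_pos (t n) with h | h
    · have : 0 < entropicTime (wp n) (wm n) := div_pos h3.2.1 h2
      simp only [h, Nat.cast_zero, norm_zero, mul_zero, norm_le_zero_iff] at h1
      exact absurd h1 this.ne'
    · exact_mod_cast h
  constructor
  · intro hρ1
    obtain ⟨r, hr, hr1⟩ := exists_between (max_lt hρ1 zero_lt_one)
    have hr0 : 0 < r := (le_max_right _ _).trans_lt hr
    refine hprob _ _ ?_
    filter_upwards [hlarge, hK, hH0, ht0,
      hρ.eventually_lt_const ((le_max_left ρ 0).trans_lt hr),
      (hLL.const_mul_atTop (sub_pos.2 hr1)).eventually_ge_atTop (r * K - Real.log c)]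
      with n ⟨hn, hL, hcL, hCL⟩ hKn hH htn hrn hbig ω hω
    rw [notMem_badDegrees] at hω
    have hmass : (1 / (c * Real.log n)) ^ t n ≤ θ n := by
      rw [← Real.log_le_log_iff (by positivity) (hθ n).1, Real.log_pow, one_div, Real.log_inv,
        Real.log_mul hc.ne' hL.ne']
      rw [div_lt_iff₀ (by positivity)] at hrn
      have h1 : r * entropy (wp n) (wm n) ≤ Real.log c + Real.log (Real.log n) := by
        have := mul_le_mul_of_nonneg_left (abs_le.1 hKn).2 hr0.le
        linarith
      have h2 := mul_le_mul_of_nonneg_right h1 htn.le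
      linarith
    have : ∀ x, quenchedProb (graphOf ω) x (t n) (θ n) = 0 := fun x =>
      quenchedProb_eq_zero _ fun p =>
        (pathMass_le_pow _ (by linarith) (fun y => (hω y).1.le) p).trans hmass
    simp [this]
  · intro hρ1
    obtain ⟨r, hr1, hr⟩ := exists_between hρ1
    have hr0 : 0 < r := by linarith
    refine hprob _ _ ?_
    filter_upwards [hlarge, hK, hH0, ht0, hρ.eventually_const_lt hr,
      (hLL.const_mul_atTop (sub_pos.2 hr1)).eventually_ge_atTop (r * K + Real.log C)]
      with n ⟨hn, hL, hcL, hCL⟩ hKn hH htn hrn hbig ω hω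
    rw [notMem_badDegrees] at hω
    have hmass : θ n < (1 / (C * Real.log n)) ^ t n := by
      rw [← Real.log_lt_log_iff (hθ n).1 (by positivity), Real.log_pow, one_div, Real.log_inv,
        Real.log_mul hC.ne' hL.ne']
      rw [lt_div_iff₀ (by positivity)] at hrn
      have h1 : Real.log C + Real.log (Real.log n) ≤ r * entropy (wp n) (wm n) := by
        have := mul_le_mul_of_nonneg_left (abs_le.1 hKn).1 hr0.le
        linarith
      have h2 := mul_le_mul_of_nonneg_right h1 htn.le
      linarith
    have hdeg : ∀ x, 0 < outDegree (graphOf ω) x := fun x => by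
      have : (0 : ℝ) < outDegree (graphOf ω) x := by linarith [(hω x).1]
      exact_mod_cast this
    have : ∀ x, quenchedProb (graphOf ω) x (t n) (θ n) = 1 := fun x =>
      quenchedProb_eq_one _ hdeg fun p hp =>
        hmass.trans_le (pow_le_pathMass _ hdeg (fun y => (hω y).2.le) p hp)
    have : Nonempty (Fin n) := ⟨⟨0, hn⟩⟩
    simp [*]
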